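/- **Setting.** Let $P$ be a probability distribution on a measurable space $\mathcal W$, let $\psi(w;\theta,\eta)=\psi^a(w;\eta)\,\theta+\psi^b(w;\eta)$ be a score that is linear in $\theta\in\mathbb R$ (with $\eta$ in an arbitrary nuisance space), let $\theta_0\in\mathbb R$, let $\eta_0$ be a nuisance value, and suppose that $$\sigma:=\sqrt{\mathbb E_P\,\psi^2(W;\theta_0,\eta_0)\,/\,\{\mathbb E_P\,\psi^a(W;\eta_0)\}^2}$$ is well defined and positive. Fix $L\ge 1$. For each $n$, the indices $1,\dots,n$ are split, independently of the data and possibly using external randomness, into $L$ folds of size $\lfloor n/L\rfloor$ or $\lfloor n/L\rfloor+1$. From iid $W_1,\dots,W_n\sim P$, let $\hat\eta^{(-l)}$ be a nuisance estimate computed from the data outside the $l$-th fold (and possibly external randomness), and let $\hat\theta_n^{(l)}$, assumed measurable, be the solution $\theta$ of $$\sum_{i\in\text{fold }l}\psi(W_i;\theta,\hat\eta^{(-l)})=0,\qquad l=1,\dots,L,$$ with the convention $\hat\theta_n^{(l)}=0$ if $\sum_{i\in\text{fold }l}\psi^a(W_i;\hat\eta^{(-l)})=0$. The external randomness is independent of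 the data. **The estimator $\hat\sigma_{\mathrm{ls}}$.** Let $m=m(n)$ be a sequence of positive integers with $m\to\infty$ and $m/n\to0$, let $J\ge1$ be a fixed integer, and let $B=J\lfloor n/m\rfloor$. Draw $J$ independent uniformly random permutations of $\{1,\dots,n\}$, independently of the data, and cut each of them into $\lfloor n/m\rfloor$ consecutive disjoint blocks of length $m$ (the last $n-m\lfloor n/m\rfloor$ positions being unused). This gives $B$ ordered subsamples of size $m$. Let $\hat\theta_{m,b}^{(l)}$ be the estimator $\hat\theta_m^{(l)}$ computed from the $b$-th subsample, with independently regenerated external randomness for each subsample. Let $\mathbb F$ be the empirical distribution function of the $BL$ numbers $\hat\theta_{m,b}^{(l)}$, let $\Phi$ be the standard normal distribution function, and put $$\tilde H_{b,l}=\Phi^{-1}\!\left(\mathbb F(\hat\theta_{m,b}^{(l)})-\tfrac1{2BL}\right).$$ For a fixed $\epsilon\in(0,1)$, let $\hat\beta_1$ be the slope of the least-squares regression (with intercept) of $\tilde H_{b,l}$ on $\hat\theta_{m,b}^{(l)}$ over those pairs $(b,l)$ for which $\mathbb F(\hat\theta_{m,b}^{(l)})\in(\epsilon/2,\,1-\epsilon/2)$,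 and let $$\hat\sigma_{\mathrm{ls}}:=\sqrt{m/L}\,/\,\hat\beta_1 .$$ **Proposition.** Suppose that for every $n$ the vector $(\hat\theta_n^{(1)},\dots,\hat\theta_n^{(L)})$ is exchangeable, and that $$T_n^{(l)}:=\frac{\sqrt{n/L}\,(\hat\theta_n^{(l)}-\theta_0)}{\sigma}\ \to_d\ \mathcal N(0,1)\quad\text{as } n\to\infty,\qquad l=1,\dots,L .$$ Then $\hat\sigma_{\mathrm{ls}}\to_p\sigma$ as $n\to\infty$. -/

import Mathlib

open MeasureTheory ProbabilityTheory Filter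
open scoped Topology

namespace DML

noncomputable section

/-- The discrete σ-algebra on the finite set of permutations of `n` indices. -/
instance permMeasurableSpace (n : ℕ) : MeasurableSpace (Equiv.Perm (Fin n)) := ⊤

/-! ### Empirical distribution function, rank transform, least squares -/

/-- Empirical distribution function of the finite family `x`. -/
def empCDF {ι : Type*} [Fintype ι] (x : ι → ℝ) (t : ℝ) : ℝ :=
  (Nat.card {i // x i ≤ t} : ℝ) / Fintype.card ι

/-- Standard normal quantile function, `inf {x | u ≤ Φ x}`. -/
def stdNormalQuantile (u : ℝ) : ℝ :=
  sInf {x : ℝ | u ≤ cdf (gaussianReal 0 1) x}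

/-- Standard normal rank transform of the family `x` with `N` entries: the `i`-th entry is
`Φ⁻¹ (F (x i) - 1 / (2 N))`, where `F` is the empirical distribution function of `x`. -/
def rankTransform {ι : Type*} [Fintype ι] (x : ι → ℝ) (i : ι) : ℝ :=
  stdNormalQuantile (empCDF x (x i) - 1 / (2 * (Fintype.card ι : ℝ)))

open scoped Classical in
/-- The indices at which the empirical distribution function lies in `(ε/2, 1 - ε/2)`. -/
def trimmed {ι : Type*} [Fintype ι] (ε : ℝ) (x : ι → ℝ) : Finset ι :=
  {i | empCDF x (x i) ∈ Set.Ioo (ε / 2) (1 - ε / 2)}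

/-- Average of `x` over the indices in `s`. -/
def average {ι : Type*} (s : Finset ι) (x : ι → ℝ) : ℝ :=
  (∑ i ∈ s, x i) / (s.card : ℝ)

/-- Slope of the least-squares regression of `y` on `x` with an intercept, over the points whose
index is in `s`. -/
def lsSlope {ι : Type*} (s : Finset ι) (x y : ι → ℝ) : ℝ :=
  (∑ i ∈ s, (x i - average s x) * (y i - average s y)) / ∑ i ∈ s, (x i - average s x) ^ 2

/-! ### Exchangeability and convergence in probability -/

/-- The finite family `X` is exchangeable under `μ`: its joint law is invariant under
permutations. -/
def Exchangeable {Ω : Type*} [MeasurableSpace Ω] {L : ℕ} (X : Fin L → Ω → ℝ)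
    (μ : Measure Ω) : Prop :=
  ∀ τ : Equiv.Perm (Fin L),
    μ.map (fun ω (l : Fin L) => X (τ l) ω) = μ.map (fun ω (l : Fin L) => X l ω)

/-- `X n → c` in probability, where `X n` is defined on its own probability space. -/
def TendstoInProbability {Ω : ℕ → Type*} [∀ n, MeasurableSpace (Ω n)]
    (μ : (n : ℕ) → Measure (Ω n)) (X : (n : ℕ) → Ω n → ℝ) (c : ℝ) : Prop :=
  ∀ δ : ℝ, 0 < δ → Tendsto (fun n => μ n {ω | δ ≤ |X n ω - c|}) atTop (𝓝 0)

/-! ### Per-fold DML estimators -/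

section Estimator

variable {𝒲 U H : Type*} {L : ℕ}

/-- The score `ψ(w; θ, η) = ψᵃ(w; η) θ + ψᵇ(w; η)`. -/
def score (ψa ψb : 𝒲 → H → ℝ) (w : 𝒲) (θ : ℝ) (η : H) : ℝ :=
  ψa w η * θ + ψb w η

/-- The `l`-th fold of a sample of size `n`; the split may depend on the external randomness `u`
but not on the data. -/
def foldSet (fold : (n : ℕ) → U → Fin n → Fin L) (n : ℕ) (l : Fin L) (u : U) : Finset (Fin n) :=
  {i | fold n u i = l}

/-- The folds have (almost) equal sizes: `⌊n/L⌋` or `⌊n/L⌋ + 1`, hence exactly `n/L` if `L`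
divides `n`. -/
def BalancedFolds (fold : (n : ℕ) → U → Fin n → Fin L) : Prop :=
  ∀ (n : ℕ) (l : Fin L) (u : U),
    n / L ≤ (foldSet fold n l u).card ∧ (foldSet fold n l u).card ≤ n / L + 1

/-- The nuisance estimate `η̂⁽⁻ˡ⁾`: the learner is given only the data outside the `l`-th fold,
and the external randomness. -/
def etaHat (fold : (n : ℕ) → U → Fin n → Fin L)
    (learner : (n : ℕ) → Fin L → (I : Finset (Fin n)) → (I → 𝒲) → U → H)
    (n : ℕ) (l : Fin L) (w : Fin n → 𝒲) (u : U) : H :=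
  learner n l (foldSet fold n l u)ᶜ (fun i => w i) u

/-- The `l`-th per-fold estimator: the solution `θ` of
`∑_{i in fold l} ψ(wᵢ; θ, η̂⁽⁻ˡ⁾) = 0` (and `0` if `∑_{i in fold l} ψᵃ(wᵢ; η̂⁽⁻ˡ⁾) = 0`). -/
def thetaHat (ψa ψb : 𝒲 → H → ℝ) (fold : (n : ℕ) → U → Fin n → Fin L)
    (learner : (n : ℕ) → Fin L → (I : Finset (Fin n)) → (I → 𝒲) → U → H)
    (n : ℕ) (l : Fin L) (w : Fin n → 𝒲) (u : U) : ℝ :=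
  -(∑ i ∈ foldSet fold n l u, ψb (w i) (etaHat fold learner n l w u)) /
    ∑ i ∈ foldSet fold n l u, ψa (w i) (etaHat fold learner n l w u)

/-- `thetaHat` does solve the estimating equation, and is its only solution. -/
theorem estimating_equation_iff (ψa ψb : 𝒲 → H → ℝ) (fold : (n : ℕ) → U → Fin n → Fin L)
    (learner : (n : ℕ) → Fin L → (I : Finset (Fin n)) → (I → 𝒲) → U → H)
    (n : ℕ) (l : Fin L) (w : Fin n → 𝒲) (u : U)
    (h : ∑ i ∈ foldSet fold n l u, ψa (w i) (etaHat fold learner n l w u) ≠ 0) (θ : ℝ) :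
    ∑ i ∈ foldSet fold n l u, score ψa ψb (w i) θ (etaHat fold learner n l w u) = 0 ↔
      θ = thetaHat ψa ψb fold learner n l w u := by
  simp only [score, thetaHat, Finset.sum_add_distrib, ← Finset.sum_mul]
  rw [eq_div_iff h]
  constructor <;> intro h' <;> linarith

/-- The asymptotic standard deviation, `σ² = E ψ²(W; θ₀, η₀) / {E ψᵃ(W; η₀)}²`. -/
def sigma [MeasurableSpace 𝒲] (P : Measure 𝒲) (ψa ψb : 𝒲 → H → ℝ) (θ₀ : ℝ) (η₀ : H) : ℝ :=
  Real.sqrt ((∫ w, score ψa ψb w θ₀ η₀ ^ 2 ∂P) / (∫ w, ψa w η₀ ∂P) ^ 2)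

/-- Law of an iid sample of size `n` together with independent external randomness. -/
def sampleLaw [MeasurableSpace 𝒲] [MeasurableSpace U] (P : Measure 𝒲) (ν : Measure U) (n : ℕ) :
    Measure ((Fin n → 𝒲) × U) :=
  (Measure.pi fun _ : Fin n => P).prod ν

instance [MeasurableSpace 𝒲] [MeasurableSpace U] (P : Measure 𝒲) (ν : Measure U)
    [IsProbabilityMeasure P] [IsProbabilityMeasure ν] (n : ℕ) :
    IsProbabilityMeasure (sampleLaw P ν n) := by
  unfold sampleLaw
  infer_instance

end Estimator

/-! ### Subsampling -/

section Subsampling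

variable {𝒲 U : Type*} {L : ℕ}

theorem block_lt {n m : ℕ} (k : Fin (n / m)) (i : Fin m) : k.val * m + i.val < n :=
  calc k.val * m + i.val < k.val * m + m := by have := i.isLt; omega
    _ = (k.val + 1) * m := by ring
    _ ≤ n / m * m := Nat.mul_le_mul_right m k.isLt
    _ ≤ n := Nat.div_mul_le_self n m

/-- The subsample `(w_{π(km)}, …, w_{π(km+m-1)})` (indices from `0`). -/
def subsample {n m : ℕ} (w : Fin n → 𝒲) (π : Equiv.Perm (Fin n)) (k : Fin (n / m)) : Fin m → 𝒲 :=
  fun i => w (π ⟨k.val * m + i.val, block_lt k i⟩)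

/-- Everything that is random: the data, `J` permutations of the data indices, and, for each of the
`B = J ⌊n/m⌋` subsamples, its own external randomness. -/
abbrev Space (𝒲 U : Type*) (J n m : ℕ) : Type _ :=
  (Fin n → 𝒲) × (Fin J → Equiv.Perm (Fin n)) × (Fin J × Fin (n / m) → U)

/-- Data iid from `P`, permutations iid uniform, external random elements iid from `ν`, all
independent. -/
def law [MeasurableSpace 𝒲] [MeasurableSpace U] (P : Measure 𝒲) (ν : Measure U) (J n m : ℕ) :
    Measure (Space 𝒲 U J n m) :=
  (Measure.pi fun _ : Fin n => P).prod
    ((Measure.pi fun _ : Fin J => (PMF.uniformOfFintype (Equiv.Perm (Fin n))).toMeasure).prod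
      (Measure.pi fun _ : Fin J × Fin (n / m) => ν))

/-- The `B × L` family of estimates: entry `(b, l)` is the `l`-th estimate from the `b`-th
subsample. -/
def subEstimates {J n m : ℕ} (est : Fin L → (Fin m → 𝒲) → U → ℝ) (ω : Space 𝒲 U J n m)
    (bl : (Fin J × Fin (n / m)) × Fin L) : ℝ :=
  est bl.2 (subsample ω.1 (ω.2.1 bl.1.1) bl.1.2) (ω.2.2 bl.1)

/-- The estimator `σ̂_ls = √(m/L) / β̂₁`, with `β̂₁` the least-squares slope of the rank-transformed
subsampled statistics on the subsampled estimates, over the points whose empirical distribution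
function is in `(ε/2, 1 - ε/2)`. -/
def sigmaLS {J n m : ℕ} (ε : ℝ) (est : Fin L → (Fin m → 𝒲) → U → ℝ) (ω : Space 𝒲 U J n m) : ℝ :=
  Real.sqrt ((m : ℝ) / L) /
    lsSlope (trimmed ε (subEstimates est ω)) (subEstimates est ω)
      (rankTransform (subEstimates est ω))

end Subsampling

end

end DML

namespace DML

/-! ### Least-squares slopes -/

section LeastSquares

variable {ι : Type*}

/-! Standardise the estimates to T = √(m/L)(θ̂ − θ₀)/σ. Ranks and trimming depend only on order, and
the slope scales inversely with its regressor, so the estimator equals σ divided by the slope for T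
(`abs_sigmaLS_sub_lt`). It remains to show that this slope tends to 1 in probability.

Deterministic half (`exists_lsSlope_close`): if the empirical distribution function F of T is close
to Φ at finitely many points and there are enough points, then each trimmed T nearly equals its
normal score Φ⁻¹(F(T) − 1/(2N)), while the trimmed T keep a fixed share of spread. The regression is
then almost that of T on itself.

Probabilistic half (`measure_law_le_abs_empCDF_block_sub_le`): for a fixed permutation and fold, the
estimates come from disjoint blocks, hence are independent with the law of the size-m estimator.
Chebyshev over the ⌊n/m⌋ → ∞ blocks brings their empirical distribution function close to the true
one, which tends to Φ by the assumed limit law. A union bound over the fixed finite set of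
permutations, folds and grid points finishes; dependence between folds or permutations is harmless.
-/

theorem sum_sub_average (s : Finset ι) (x : ι → ℝ) : ∑ i ∈ s, (x i - average s x) = 0 := by
  rcases s.eq_empty_or_nonempty with rfl | hs
  · simp
  · have : (s.card : ℝ) ≠ 0 := by exact_mod_cast hs.card_pos.ne'
    rw [Finset.sum_sub_distrib, Finset.sum_const, nsmul_eq_mul, average]
    field_simp
    ring

theorem average_affine {s : Finset ι} (hs : s.Nonempty) (x : ι → ℝ) (c a : ℝ) :
    average s (fun i => c * (x i - a)) = c * (average s x - a) := by
  have : (s.card : ℝ) ≠ 0 := by exact_mod_cast hs.card_pos.ne'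
  simp only [average]
  rw [← Finset.mul_sum, Finset.sum_sub_distrib, Finset.sum_const, nsmul_eq_mul]
  field_simp

theorem lsSlope_affine (s : Finset ι) (x y : ι → ℝ) {c : ℝ} (hc : c ≠ 0) (a : ℝ) :
    lsSlope s (fun i => c * (x i - a)) y = lsSlope s x y / c := by
  rcases s.eq_empty_or_nonempty with rfl | hs
  · simp [lsSlope]
  · have h : ∀ i, c * (x i - a) - c * (average s x - a) = c * (x i - average s x) :=
      fun i => by ring
    simp only [lsSlope, average_affine hs, h, mul_assoc, mul_pow, ← Finset.mul_sum]
    rw [pow_two, mul_assoc, mul_div_mul_left _ _ hc, mul_comm c, div_mul_eq_div_div]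

/-- Centred sums ignore constants, so numerator minus denominator is ∑(x − x̄)(y − x). The bound |a|
≤ (a² + 1)/2 controls it by the denominator and the number of points, and `hvar` absorbs the latter.
-/
theorem abs_lsSlope_sub_one_le {s : Finset ι} (hs : s.Nonempty) {x y : ι → ℝ} {δ κ : ℝ}
    (hκ : 0 < κ) (hxy : ∀ i ∈ s, |y i - x i| ≤ δ)
    (hvar : κ * s.card ≤ ∑ i ∈ s, (x i - average s x) ^ 2) :
    |lsSlope s x y - 1| ≤ δ * (1 + 1 / κ) / 2 := by
  have hN : (0 : ℝ) < s.card := by exact_mod_cast hs.card_pos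
  obtain ⟨i₀, hi₀⟩ := hs
  have hδ : 0 ≤ δ := (abs_nonneg _).trans (hxy i₀ hi₀)
  set S := ∑ i ∈ s, (x i - average s x) ^ 2 with hS
  have hSpos : 0 < S := (mul_pos hκ hN).trans_le hvar
  have hnum : ∑ i ∈ s, (x i - average s x) * (y i - average s y) - S
      = ∑ i ∈ s, (x i - average s x) * (y i - x i) := by
    have : ∀ i, (x i - average s x) * (y i - average s y) - (x i - average s x) ^ 2
        = (x i - average s x) * (y i - x i)
          + (x i - average s x) * (average s x - average s y) := fun i => by ring
    rw [hS, ← Finset.sum_sub_distrib, Finset.sum_congr rfl fun i _ => this i,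
      Finset.sum_add_distrib, ← Finset.sum_mul, sum_sub_average, zero_mul, add_zero]
  have hbound : |∑ i ∈ s, (x i - average s x) * (y i - x i)| ≤ δ * ((S + s.card) / 2) := by
    calc |∑ i ∈ s, (x i - average s x) * (y i - x i)|
        ≤ ∑ i ∈ s, |(x i - average s x) * (y i - x i)| := Finset.abs_sum_le_sum_abs _ _
      _ ≤ ∑ i ∈ s, δ * (((x i - average s x) ^ 2 + 1) / 2) := by
          refine Finset.sum_le_sum fun i hi => ?_
          rw [abs_mul, mul_comm]
          refine mul_le_mul (hxy i hi) ?_ (abs_nonneg _) hδ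
          nlinarith [sq_nonneg (|x i - average s x| - 1), sq_abs (x i - average s x)]
      _ = δ * ((S + s.card) / 2) := by
          rw [← Finset.mul_sum, ← Finset.sum_div, Finset.sum_add_distrib, Finset.sum_const,
            nsmul_eq_mul, mul_one]
  have hNS : (s.card : ℝ) ≤ S / κ := by rw [le_div_iff₀ hκ]; linarith
  have heq : lsSlope s x y - 1 = (∑ i ∈ s, (x i - average s x) * (y i - x i)) / S := by
    rw [← hnum, lsSlope, ← hS]
    field_simp
  rw [heq, abs_div, abs_of_pos hSpos, div_le_iff₀ hSpos]
  refine hbound.trans ?_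
  have : δ * (1 + 1 / κ) / 2 * S = δ * ((S + S / κ) / 2) := by field_simp
  rw [this]
  gcongr

/-- Wherever z lies relative to the midpoint of p and q, all of `A` or all of `B` is at distance at
least (q − p)/2 from it. -/
theorem mul_sq_le_sum_sub_sq {s A B : Finset ι} {x : ι → ℝ} {p q c : ℝ} (hpq : p ≤ q)
    (hA : A ⊆ s) (hB : B ⊆ s) (hxA : ∀ i ∈ A, x i ≤ p) (hxB : ∀ i ∈ B, q ≤ x i)
    (hcA : c ≤ A.card) (hcB : c ≤ B.card) (z : ℝ) :
    c * ((q - p) / 2) ^ 2 ≤ ∑ i ∈ s, (x i - z) ^ 2 := by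
  have key : ∀ C ⊆ s, c ≤ (C.card : ℝ) → (∀ i ∈ C, ((q - p) / 2) ^ 2 ≤ (x i - z) ^ 2) →
      c * ((q - p) / 2) ^ 2 ≤ ∑ i ∈ s, (x i - z) ^ 2 := by
    intro C hC hcC h
    calc c * ((q - p) / 2) ^ 2 ≤ C.card * ((q - p) / 2) ^ 2 := by gcongr
      _ = ∑ i ∈ C, ((q - p) / 2) ^ 2 := by rw [Finset.sum_const, nsmul_eq_mul]
      _ ≤ ∑ i ∈ C, (x i - z) ^ 2 := Finset.sum_le_sum h
      _ ≤ ∑ i ∈ s, (x i - z) ^ 2 :=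
          Finset.sum_le_sum_of_subset_of_nonneg hC fun _ _ _ => sq_nonneg _
  rcases le_total z ((p + q) / 2) with hz | hz
  · refine key B hB hcB fun i hi => ?_
    have := hxB i hi
    exact pow_le_pow_left₀ (by linarith) (by linarith) 2
  · refine key A hA hcA fun i hi => ?_
    have := hxA i hi
    rw [← neg_sq (x i - z)]
    exact pow_le_pow_left₀ (by linarith) (by linarith) 2

end LeastSquares

/-! ### Empirical distribution functions -/

section Empirical

variable {ι : Type*} [Fintype ι]

open scoped Classical in
theorem empCDF_eq_card_filter (x : ι → ℝ) (t : ℝ) :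
    empCDF x t = ((Finset.univ.filter fun i => x i ≤ t).card : ℝ) / Fintype.card ι := by
  rw [empCDF, Nat.card_eq_fintype_card, Fintype.card_subtype]

open scoped Classical in
theorem empCDF_eq_sum (x : ι → ℝ) (t : ℝ) :
    empCDF x t = (∑ i, if x i ≤ t then (1 : ℝ) else 0) / Fintype.card ι := by
  rw [empCDF_eq_card_filter, Finset.sum_boole]

theorem monotone_empCDF (x : ι → ℝ) : Monotone (empCDF x) := by
  classical
  intro t u htu
  rw [empCDF_eq_card_filter, empCDF_eq_card_filter]
  gcongr

theorem empCDF_affine (x : ι → ℝ) {c : ℝ} (hc : 0 < c) (a t : ℝ) :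
    empCDF (fun i => c * (x i - a)) (c * (t - a)) = empCDF x t := by
  simp only [empCDF, mul_le_mul_iff_right₀ hc, sub_le_sub_iff_right]

theorem rankTransform_affine (x : ι → ℝ) {c : ℝ} (hc : 0 < c) (a : ℝ) :
    rankTransform (fun i => c * (x i - a)) = rankTransform x := by
  funext i
  simp only [rankTransform]
  rw [empCDF_affine x hc]

theorem trimmed_affine (ε : ℝ) (x : ι → ℝ) {c : ℝ} (hc : 0 < c) (a : ℝ) :
    trimmed ε (fun i => c * (x i - a)) = trimmed ε x := by
  ext i
  simp only [trimmed, Finset.mem_filter]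
  rw [empCDF_affine x hc]

open scoped Classical in
theorem card_filter_Ioc [Nonempty ι] (x : ι → ℝ) {a b : ℝ} (hab : a ≤ b) :
    ((Finset.univ.filter fun i => a < x i ∧ x i ≤ b).card : ℝ)
      = Fintype.card ι * (empCDF x b - empCDF x a) := by
  have hN : (Fintype.card ι : ℝ) ≠ 0 := by exact_mod_cast Fintype.card_ne_zero
  have h : Finset.univ.filter (fun i => x i ≤ b)
      = Finset.univ.filter (fun i => x i ≤ a) ∪
        Finset.univ.filter (fun i => a < x i ∧ x i ≤ b) := by
    ext i
    simp only [Finset.mem_filter, Finset.mem_univ, true_and, Finset.mem_union]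
    constructor
    · intro h
      rcases le_or_gt (x i) a with h' | h'
      · exact Or.inl h'
      · exact Or.inr ⟨h', h⟩
    · rintro (h | h)
      · exact h.trans hab
      · exact h.2
  rw [empCDF_eq_card_filter, empCDF_eq_card_filter, h, Finset.card_union_of_disjoint]
  · push_cast
    field_simp
    ring
  · rw [Finset.disjoint_filter]
    intro i _ h1 h2
    exact absurd h2.1 (not_lt.2 h1)

/-- With slices of equal size, the pooled function is the plain average of the slice functions. Here
`κ` will index blocks and `α` pairs of permutation and fold. -/
theorem abs_empCDF_prod_sub_lt {κ α : Type*} [Fintype κ] [Fintype α] [Nonempty α]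
    (e : κ × α ≃ ι) {x : ι → ℝ} {t c η : ℝ} [Nonempty κ]
    (h : ∀ a, |empCDF (fun k => x (e (k, a))) t - c| < η) : |empCDF x t - c| < η := by
  classical
  have hκ : (Fintype.card κ : ℝ) ≠ 0 := by exact_mod_cast Fintype.card_ne_zero
  have hα : (0 : ℝ) < Fintype.card α := by exact_mod_cast Fintype.card_pos
  have hcard : Fintype.card ι = Fintype.card κ * Fintype.card α := by
    rw [← Fintype.card_congr e, Fintype.card_prod]
  have havg : empCDF x t - c
      = (∑ a, (empCDF (fun k => x (e (k, a))) t - c)) / Fintype.card α := by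
    rw [Finset.sum_sub_distrib, Finset.sum_const, nsmul_eq_mul, Finset.card_univ]
    simp only [empCDF_eq_sum]
    rw [← Finset.sum_div, ← e.sum_comp, Fintype.sum_prod_type_right, hcard]
    push_cast
    field_simp
  rw [havg, abs_div, abs_of_pos hα, div_lt_iff₀ hα]
  calc |∑ a, (empCDF (fun k => x (e (k, a))) t - c)|
      ≤ ∑ a, |empCDF (fun k => x (e (k, a))) t - c| := Finset.abs_sum_le_sum_abs _ _
    _ < ∑ _a : α, η := Finset.sum_lt_sum_of_nonempty Finset.univ_nonempty fun a _ => h a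
    _ = η * Fintype.card α := by
        rw [Finset.sum_const, nsmul_eq_mul, Finset.card_univ, mul_comm]

end Empirical

/-! ### The standard normal distribution function -/

section Normal

local notation "Φ" => cdf (gaussianReal 0 1)

instance nullSingletonClass_stdGaussian : NullSingletonClass (gaussianReal 0 1) :=
  nullSingletonClass_gaussianReal one_ne_zero

/-- The jump at a point is the Gaussian mass of that point, which is zero. -/
theorem continuous_cdf_stdGaussian : Continuous Φ := by
  rw [continuous_iff_continuousAt]
  intro x
  rw [(monotone_cdf (gaussianReal 0 1)).continuousAt_iff_leftLim_eq_rightLim,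
    StieltjesFunction.rightLim_eq]
  have h : (cdf (gaussianReal 0 1)).measure {x} = 0 := by
    rw [measure_cdf]; exact measure_singleton x
  rw [StieltjesFunction.measure_singleton, ENNReal.ofReal_eq_zero] at h
  exact le_antisymm ((monotone_cdf _).leftLim_le le_rfl) (by linarith)

/-- A flat stretch would be Gaussian-null, hence Lebesgue-null. -/
theorem strictMono_cdf_stdGaussian : StrictMono Φ := by
  intro x y hxy
  by_contra h
  have h' : (cdf (gaussianReal 0 1)).measure (Set.Ioc x y) = 0 := by
    rw [StieltjesFunction.measure_Ioc, ENNReal.ofReal_eq_zero]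
    linarith
  rw [measure_cdf] at h'
  have := gaussianReal_absolutelyContinuous' 0 (one_ne_zero) h'
  rw [Real.volume_Ioc, ENNReal.ofReal_eq_zero] at this
  linarith

theorem exists_cdf_stdGaussian_eq {p : ℝ} (hp : p ∈ Set.Ioo (0 : ℝ) 1) : ∃ x, Φ x = p := by
  obtain ⟨a, ha⟩ := ((tendsto_cdf_atBot (gaussianReal 0 1)).eventually_lt_const hp.1).exists
  obtain ⟨b, hb⟩ := ((tendsto_cdf_atTop (gaussianReal 0 1)).eventually_const_lt hp.2).exists
  exact mem_range_of_exists_le_of_exists_ge continuous_cdf_stdGaussian ⟨a, ha.le⟩ ⟨b, hb.le⟩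

theorem stdNormalQuantile_mem_Icc {u a b : ℝ} (ha : Φ a < u) (hb : u ≤ Φ b) :
    stdNormalQuantile u ∈ Set.Icc a b := by
  have hlb : ∀ x ∈ {x : ℝ | u ≤ Φ x}, a ≤ x := fun x hx =>
    ((strictMono_cdf_stdGaussian.lt_iff_lt).1 (ha.trans_le hx)).le
  exact ⟨le_csInf ⟨b, hb⟩ hlb, csInf_le ⟨a, hlb⟩ hb⟩

end Normal

end DML

namespace DML

/-! ### Deterministic control of the regression slope. -/

section Regression

local notation "Φ" => cdf (gaussianReal 0 1)

/-- Four increasing arguments at which the normal distribution function lies in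
`(ε/2, 1 - ε/2)`. -/
theorem exists_four_quantiles {ε : ℝ} (hε : 0 < ε) (hε' : ε < 1) :
    ∃ q₁ q₂ q₃ q₄ : ℝ, q₁ < q₂ ∧ q₂ < q₃ ∧ q₃ < q₄ ∧ ε / 2 < Φ q₁ ∧ Φ q₄ < 1 - ε / 2 := by
  set h := (1 - ε) / 5 with hh
  have hpos : 0 < h := by rw [hh]; linarith
  obtain ⟨q₁, h₁⟩ := exists_cdf_stdGaussian_eq (p := ε / 2 + h) ⟨by linarith, by linarith⟩
  obtain ⟨q₂, h₂⟩ := exists_cdf_stdGaussian_eq (p := ε / 2 + 2 * h) ⟨by linarith, by linarith⟩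
  obtain ⟨q₃, h₃⟩ := exists_cdf_stdGaussian_eq (p := ε / 2 + 3 * h) ⟨by linarith, by linarith⟩
  obtain ⟨q₄, h₄⟩ := exists_cdf_stdGaussian_eq (p := ε / 2 + 4 * h) ⟨by linarith, by linarith⟩
  have hlt := fun a b => strictMono_cdf_stdGaussian.lt_iff_lt (a := a) (b := b)
  refine ⟨q₁, q₂, q₃, q₄, (hlt _ _).1 ?_, (hlt _ _).1 ?_, (hlt _ _).1 ?_, ?_, ?_⟩ <;> linarith

/-- If the empirical distribution function is close to `Φ` at finitely many points, then a fixed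
share of the spread survives trimming. -/
theorem exists_trimmed_spread {ε : ℝ} (hε : 0 < ε) (hε' : ε < 1) :
    ∃ κ > 0, ∃ S : Finset ℝ, ∃ η > 0, ∀ (ι : Type) [Fintype ι] [Nonempty ι] (x : ι → ℝ),
      (∀ t ∈ S, |empCDF x t - Φ t| < η) →
        (trimmed ε x).Nonempty ∧ κ * (trimmed ε x).card
          ≤ ∑ i ∈ trimmed ε x, (x i - average (trimmed ε x) x) ^ 2 := by
  classical
  obtain ⟨q₁, q₂, q₃, q₄, h12, h23, h34, hq₁, hq₄⟩ := exists_four_quantiles hε hε'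
  have h12' := strictMono_cdf_stdGaussian h12
  have h23' := strictMono_cdf_stdGaussian h23
  have h34' := strictMono_cdf_stdGaussian h34
  -- A quarter of the smallest gap: with tolerance η = c, two evaluation errors still leave mass at
  -- least 2c between neighbouring quantiles.
  obtain ⟨c, hc, hc12, hc34, hc1, hc4⟩ : ∃ c > 0, 4 * c ≤ Φ q₂ - Φ q₁ ∧ 4 * c ≤ Φ q₄ - Φ q₃ ∧
      4 * c ≤ Φ q₁ - ε / 2 ∧ 4 * c ≤ 1 - ε / 2 - Φ q₄ := by
    refine ⟨min (min (Φ q₂ - Φ q₁) (Φ q₄ - Φ q₃)) (min (Φ q₁ - ε / 2) (1 - ε / 2 - Φ q₄)) / 4,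
      ?_, ?_, ?_, ?_, ?_⟩
    · have : 0 < min (min (Φ q₂ - Φ q₁) (Φ q₄ - Φ q₃)) (min (Φ q₁ - ε / 2) (1 - ε / 2 - Φ q₄)) :=
        lt_min (lt_min (by linarith) (by linarith)) (lt_min (by linarith) (by linarith))
      linarith
    all_goals rw [mul_div_cancel₀ _ (by norm_num : (4 : ℝ) ≠ 0)]
    · exact (min_le_left _ _).trans (min_le_left _ _)
    · exact (min_le_left _ _).trans (min_le_right _ _)
    · exact (min_le_right _ _).trans (min_le_left _ _)
    · exact (min_le_right _ _).trans (min_le_right _ _)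
  have hd : 0 < (q₃ - q₂) / 2 := by linarith
  refine ⟨c * ((q₃ - q₂) / 2) ^ 2, by positivity, {q₁, q₂, q₃, q₄}, c, hc, ?_⟩
  intro ι _ _ x hS
  have e₁ := abs_lt.1 (hS q₁ (by simp))
  have e₂ := abs_lt.1 (hS q₂ (by simp))
  have e₃ := abs_lt.1 (hS q₃ (by simp))
  have e₄ := abs_lt.1 (hS q₄ (by simp))
  have hmem : ∀ i, q₁ < x i → x i ≤ q₄ → i ∈ trimmed ε x := by
    intro i h1 h4
    have := monotone_empCDF x h1.le
    have := monotone_empCDF x h4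
    rw [trimmed, Finset.mem_filter]
    exact ⟨Finset.mem_univ _, by linarith, by linarith⟩
  have hN : (0 : ℝ) < Fintype.card ι := by exact_mod_cast Fintype.card_pos
  -- Two groups that survive trimming, each a share at least c of all points, separated by the gap
  -- from q₂ to q₃.
  set A := Finset.univ.filter fun i => q₁ < x i ∧ x i ≤ q₂ with hA
  set B := Finset.univ.filter fun i => q₃ < x i ∧ x i ≤ q₄ with hB
  have hAs : A ⊆ trimmed ε x := fun i hi => by
    have := (Finset.mem_filter.1 hi).2
    exact hmem i this.1 (by linarith)
  have hBs : B ⊆ trimmed ε x := fun i hi => by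
    have := (Finset.mem_filter.1 hi).2
    exact hmem i (by linarith) this.2
  have hcA : c * Fintype.card ι ≤ (A.card : ℝ) := by
    rw [hA, card_filter_Ioc x h12.le, mul_comm]
    exact mul_le_mul_of_nonneg_left (by linarith) hN.le
  have hcB : c * Fintype.card ι ≤ (B.card : ℝ) := by
    rw [hB, card_filter_Ioc x h34.le, mul_comm]
    exact mul_le_mul_of_nonneg_left (by linarith) hN.le
  constructor
  · have : (0 : ℝ) < A.card := (mul_pos hc hN).trans_le hcA
    exact (Finset.card_pos.1 (by exact_mod_cast this)).mono hAs
  · refine le_trans ?_ (mul_sq_le_sum_sub_sq h23.le hAs hBs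
      (fun i hi => (Finset.mem_filter.1 hi).2.2) (fun i hi => (Finset.mem_filter.1 hi).2.1.le)
      hcA hcB (average (trimmed ε x) x))
    have : ((trimmed ε x).card : ℝ) ≤ Fintype.card ι := by exact_mod_cast Finset.card_le_univ _
    rw [mul_right_comm]
    gcongr

/-- If the empirical distribution function is close to `Φ` at finitely many points, then normal
ranks are close to the values themselves, uniformly over the trimmed points. -/
theorem exists_rankTransform_close {ε δ : ℝ} (hε : 0 < ε) (hδ : 0 < δ) :
    ∃ S : Finset ℝ, ∃ η > 0, ∃ N₀ : ℕ, ∀ (ι : Type) [Fintype ι] [Nonempty ι] (x : ι → ℝ),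
      N₀ ≤ Fintype.card ι → (∀ t ∈ S, |empCDF x t - Φ t| < η) →
        ∀ i ∈ trimmed ε x, |rankTransform x i - x i| ≤ 2 * δ := by
  classical
  -- Grid of mesh δ. Beyond ±Mδ the normal tails are below ε/4, so with η ≤ ε/4 every trimmed point
  -- lies strictly between the ends.
  obtain ⟨M, hM1, hM2⟩ : ∃ M : ℕ, Φ (-(M * δ)) < ε / 4 ∧ 1 - ε / 4 < Φ (M * δ) := by
    have hT : Tendsto (fun M : ℕ => (M : ℝ) * δ) atTop atTop :=
      tendsto_natCast_atTop_atTop.atTop_mul_const hδ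
    have h1 := ((tendsto_cdf_atBot (gaussianReal 0 1)).comp
      (tendsto_neg_atTop_atBot.comp hT)).eventually_lt_const (by positivity : 0 < ε / 4)
    have h2 := ((tendsto_cdf_atTop (gaussianReal 0 1)).comp hT).eventually_const_lt
      (by linarith : 1 - ε / 4 < 1)
    exact (h1.and h2).exists
  have hstep : ∀ k : ℤ, Φ (k * δ) < Φ ((k + 1 : ℤ) * δ) := fun k =>
    strictMono_cdf_stdGaussian (by push_cast; linarith)
  -- η is at most half the Φ-increment of every cell, including one extra cell past each end, since
  -- the cells adjacent to that of x are used below.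
  obtain ⟨η, hη, hηε, hgap⟩ : ∃ η > 0, η ≤ ε / 4 ∧
      ∀ k ∈ Finset.Icc (-M - 1 : ℤ) M, 2 * η ≤ Φ ((k + 1 : ℤ) * δ) - Φ (k * δ) := by
    have hne : (Finset.Icc (-M - 1 : ℤ) M).Nonempty := ⟨0, by simp⟩
    obtain ⟨k₀, -, hmin⟩ := Finset.exists_min_image (Finset.Icc (-M - 1 : ℤ) M)
      (fun k : ℤ => Φ ((k + 1 : ℤ) * δ) - Φ (k * δ)) hne
    have := hstep k₀
    refine ⟨min (ε / 4) ((Φ ((k₀ + 1 : ℤ) * δ) - Φ (k₀ * δ)) / 2),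
      lt_min (by positivity) (by linarith), min_le_left _ _, fun k hk => ?_⟩
    have h1 := hmin k hk
    have h2 := min_le_right (ε / 4) ((Φ ((k₀ + 1 : ℤ) * δ) - Φ (k₀ * δ)) / 2)
    linarith
  obtain ⟨N₀, hN₀⟩ := exists_nat_gt (1 / η)
  refine ⟨(Finset.Icc (-M : ℤ) M).image fun k : ℤ => (k : ℝ) * δ, η, hη, N₀, ?_⟩
  intro ι _ _ x hN hS i hi
  replace hS : ∀ k : ℤ, -M ≤ k → k ≤ M → |empCDF x (k * δ) - Φ (k * δ)| < η := fun k h1 h2 =>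
    hS _ (Finset.mem_image_of_mem _ (Finset.mem_Icc.2 ⟨h1, h2⟩))
  obtain ⟨hi1, hi2⟩ := (Finset.mem_filter.1 hi).2
  have hlow : -(M * δ) < x i := by
    by_contra! h
    have h1 := monotone_empCDF x h
    have h2 := abs_lt.1 (hS (-M) le_rfl (by omega))
    push_cast at h2
    rw [neg_mul] at h2
    linarith
  have hhigh : x i < M * δ := by
    by_contra! h
    have h1 := monotone_empCDF x h
    have h2 := abs_lt.1 (hS M (by omega) le_rfl)
    push_cast at h2
    linarith
  set k := ⌊x i / δ⌋ with hk
  have hk1 : (k : ℝ) * δ ≤ x i := (le_div_iff₀ hδ).1 (Int.floor_le _)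
  have hk2 : x i < ((k + 1 : ℤ) : ℝ) * δ := by
    push_cast; exact (div_lt_iff₀ hδ).1 (Int.lt_floor_add_one _)
  have hkM1 : -(M : ℤ) ≤ k := by
    rw [hk, Int.le_floor]; push_cast; rw [le_div_iff₀ hδ, neg_mul]; exact hlow.le
  have hkM2 : k < M := by
    rw [hk, Int.floor_lt, div_lt_iff₀ hδ]; push_cast; exact hhigh
  have hs0 := abs_lt.1 (hS k hkM1 hkM2.le)
  have hs1 := abs_lt.1 (hS (k + 1) (by omega) (by omega))
  have hg0 := hgap (k - 1) (Finset.mem_Icc.2 ⟨by omega, by omega⟩)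
  have hg1 := hgap (k + 1) (Finset.mem_Icc.2 ⟨by omega, by omega⟩)
  rw [sub_add_cancel] at hg0
  have hF0 := monotone_empCDF x hk1
  have hF1 := monotone_empCDF x hk2.le
  have hNpos : (0 : ℝ) < Fintype.card ι := by exact_mod_cast Fintype.card_pos
  have hNη : 1 / (2 * (Fintype.card ι : ℝ)) < η := by
    have h1 : (N₀ : ℝ) ≤ Fintype.card ι := by exact_mod_cast hN
    rw [div_lt_iff₀ hη] at hN₀
    rw [div_lt_iff₀ (by positivity)]
    nlinarith
  have hN0 : 0 < 1 / (2 * (Fintype.card ι : ℝ)) := by positivity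
  -- For x in [kδ, (k+1)δ), the argument u of the quantile satisfies u > Φ(kδ) − 2η ≥ Φ((k−1)δ), one
  -- η paying for the 1/(2N) shift, and u < Φ((k+1)δ) + η ≤ Φ((k+2)δ). Hence the 2δ.
  have hq := stdNormalQuantile_mem_Icc (u := empCDF x (x i) - 1 / (2 * (Fintype.card ι : ℝ)))
    (a := ((k - 1 : ℤ) : ℝ) * δ) (b := ((k + 1 + 1 : ℤ) : ℝ) * δ) (by linarith) (by linarith)
  have hq' : rankTransform x i ∈ Set.Icc (((k - 1 : ℤ) : ℝ) * δ) (((k + 1 + 1 : ℤ) : ℝ) * δ) := hq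
  push_cast at hq' hk2
  rw [abs_le]
  constructor <;> linarith [hq'.1, hq'.2]

/-- The least-squares slope of the normal ranks over the trimmed points is close to `1` as soon as
the empirical distribution function is close to `Φ` at finitely many points. -/
theorem exists_lsSlope_close {ε δ : ℝ} (hε : 0 < ε) (hε' : ε < 1) (hδ : 0 < δ) :
    ∃ S : Finset ℝ, ∃ η > 0, ∃ N₀ : ℕ, ∀ (ι : Type) [Fintype ι] [Nonempty ι] (x : ι → ℝ),
      N₀ ≤ Fintype.card ι → (∀ t ∈ S, |empCDF x t - Φ t| < η) →
        |lsSlope (trimmed ε x) x (rankTransform x) - 1| ≤ δ := by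
  classical
  obtain ⟨κ, hκ, S₁, η₁, hη₁, h₁⟩ := exists_trimmed_spread hε hε'
  have hpos : 0 < 1 + 1 / κ := by positivity
  obtain ⟨S₂, η₂, hη₂, N₀, h₂⟩ := exists_rankTransform_close hε (div_pos hδ hpos)
  refine ⟨S₁ ∪ S₂, min η₁ η₂, lt_min hη₁ hη₂, N₀, ?_⟩
  intro ι _ _ x hN hS
  obtain ⟨hne, hvar⟩ := h₁ ι x fun t ht =>
    (hS t (Finset.mem_union_left _ ht)).trans_le (min_le_left _ _)
  have hclose := h₂ ι x hN fun t ht =>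
    (hS t (Finset.mem_union_right _ ht)).trans_le (min_le_right _ _)
  refine (abs_lsSlope_sub_one_le hne hκ hclose hvar).trans_eq ?_
  field_simp

end Regression

end DML

namespace DML

/-! ### A weak law of large numbers for empirical distribution functions -/

section WeakLaw

/-- Fubini: for fixed ω' the inner probability factors by `h`; the two factors are functions of X'
and Y', so the outer integral factors by `h'`. -/
theorem indepFun_prodMk_fst_snd {Ω Ω' E F E' F' : Type*} [MeasurableSpace Ω] [MeasurableSpace Ω']
    [MeasurableSpace E] [MeasurableSpace F] [MeasurableSpace E'] [MeasurableSpace F']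
    {μ : Measure Ω} {ν : Measure Ω'} [IsProbabilityMeasure μ] [IsProbabilityMeasure ν]
    {X : Ω → E} {Y : Ω → F} {X' : Ω' → E'} {Y' : Ω' → F'} (hX : Measurable X) (hY : Measurable Y)
    (hX' : Measurable X') (hY' : Measurable Y') (h : IndepFun X Y μ) (h' : IndepFun X' Y' ν) :
    IndepFun (fun p : Ω × Ω' => (X p.1, X' p.2)) (fun p : Ω × Ω' => (Y p.1, Y' p.2))
      (μ.prod ν) := by
  have hXX : Measurable fun p : Ω × Ω' => (X p.1, X' p.2) := by fun_prop
  have hYY : Measurable fun p : Ω × Ω' => (Y p.1, Y' p.2) := by fun_prop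
  rw [indepFun_iff_measure_inter_preimage_eq_mul]
  intro s t hs ht
  rw [Measure.prod_apply_symm ((hXX hs).inter (hYY ht)), Measure.prod_apply_symm (hXX hs),
    Measure.prod_apply_symm (hYY ht)]
  have ha : Measurable fun x' => μ (X ⁻¹' ((fun x => (x, x')) ⁻¹' s)) := by
    simpa only [Measure.map_apply hX (measurable_prodMk_right hs)]
      using measurable_measure_prodMk_right (μ := μ.map X) hs
  have hb : Measurable fun y' => μ (Y ⁻¹' ((fun y => (y, y')) ⁻¹' t)) := by
    simpa only [Measure.map_apply hY (measurable_prodMk_right ht)]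
      using measurable_measure_prodMk_right (μ := μ.map Y) ht
  have key := lintegral_mul_eq_lintegral_mul_lintegral_of_indepFun (ha.comp hX') (hb.comp hY')
    (h'.comp ha hb)
  refine Eq.trans ?_ key
  refine lintegral_congr fun ω' => ?_
  exact h.measure_inter_preimage_eq_mul ((fun x => (x, X' ω')) ⁻¹' s)
    ((fun y => (y, Y' ω')) ⁻¹' t) (measurable_prodMk_right hs)
    (measurable_prodMk_right ht)

/-- Chebyshev for a sum of K pairwise independent indicators, each of variance at most 1. -/
theorem measure_le_abs_empCDF_sub_le {Ω : Type*} [MeasurableSpace Ω] {μ : Measure Ω}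
    [IsProbabilityMeasure μ] {K : ℕ} (hK : 0 < K) {X : Fin K → Ω → ℝ}
    (hX : ∀ k, Measurable (X k)) (hind : Pairwise fun k k' => IndepFun (X k) (X k') μ) {t p η : ℝ}
    (hη : 0 < η) (hp : ∀ k, μ.real {ω | X k ω ≤ t} = p) :
    μ {ω | η ≤ |empCDF (fun k => X k ω) t - p|} ≤ ENNReal.ofReal (1 / (K * η ^ 2)) := by
  classical
  have hK' : (0 : ℝ) < K := by exact_mod_cast hK
  set g : ℝ → ℝ := (Set.Iic t).indicator 1 with hg
  have hgm : Measurable g := measurable_one.indicator measurableSet_Iic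
  have hg01 : ∀ x, g x ∈ Set.Icc (0 : ℝ) 1 := fun x => by
    rw [hg, Set.indicator_apply]
    split_ifs <;> simp
  set Z : Fin K → Ω → ℝ := fun k => g ∘ X k with hZ
  have hZm : ∀ k, Measurable (Z k) := fun k => hgm.comp (hX k)
  have hZ2 : ∀ k, MemLp (Z k) 2 μ := fun k =>
    memLp_of_bounded (ae_of_all _ fun ω => hg01 (X k ω)) (hZm k).aestronglyMeasurable 2
  have hmean : ∀ k, μ[Z k] = p := fun k => by
    have : Z k = {ω | X k ω ≤ t}.indicator 1 := rfl
    have hms : MeasurableSet {ω | X k ω ≤ t} := hX k measurableSet_Iic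
    rw [this, integral_indicator_one hms, hp]
  have hvar : Var[∑ k, Z k; μ] ≤ K := by
    rw [IndepFun.variance_sum (fun k _ => hZ2 k) fun k _ k' _ hkk' => (hind hkk').comp hgm hgm]
    calc ∑ k, Var[Z k; μ] ≤ ∑ _k : Fin K, (1 : ℝ) := by
          refine Finset.sum_le_sum fun k _ => ?_
          refine (variance_le_sq_of_bounded (ae_of_all _ fun ω => hg01 (X k ω))
            (hZm k).aemeasurable).trans ?_
          norm_num
      _ = K := by simp
  have hsum : μ[∑ k, Z k] = K * p := by
    simp only [Finset.sum_apply]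
    rw [integral_finsetSum _ fun k _ => (hZ2 k).integrable (by norm_num)]
    simp [hmean]
  have hcheb := meas_ge_le_variance_div_sq (memLp_finsetSum' Finset.univ fun k _ => hZ2 k)
    (mul_pos hK' hη)
  refine le_trans (measure_mono ?_) (hcheb.trans (ENNReal.ofReal_le_ofReal ?_))
  · intro ω hω
    have hω' : η ≤ |empCDF (fun k => X k ω) t - p| := hω
    have hemp : empCDF (fun k => X k ω) t = (∑ k, Z k) ω / K := by
      rw [empCDF_eq_sum, Finset.sum_apply, Fintype.card_fin]
      congr 1
    rw [Set.mem_ofPred_eq, hsum]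
    have : (∑ k, Z k) ω - K * p = K * ((∑ k, Z k) ω / K - p) := by field_simp
    rw [this, abs_mul, abs_of_pos hK', ← hemp]
    gcongr
  · rw [div_le_div_iff₀ (by positivity) (by positivity)]
    have : 0 ≤ η ^ 2 := sq_nonneg η
    calc Var[∑ k, Z k; μ] * (K * η ^ 2) ≤ K * (K * η ^ 2) := by gcongr
      _ = 1 * (K * η) ^ 2 := by ring

end WeakLaw

/-! ### Blocks of a permuted sample -/

section Blocks

variable {𝒲 U : Type*} [MeasurableSpace 𝒲] [MeasurableSpace U] {J n m : ℕ}

instance (n : ℕ) : DiscreteMeasurableSpace (Equiv.Perm (Fin n)) := ⟨fun _ => trivial⟩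

theorem block_injective (k : Fin (n / m)) :
    Function.Injective fun i : Fin m => (⟨k.val * m + i.val, block_lt k i⟩ : Fin n) := by
  intro i i' h
  have : k.val * m + i.val = k.val * m + i'.val := congrArg Fin.val h
  exact Fin.ext (by omega)

theorem block_ne {k k' : Fin (n / m)} (hkk' : k ≠ k') (i i' : Fin m) :
    (⟨k.val * m + i.val, block_lt k i⟩ : Fin n) ≠ ⟨k'.val * m + i'.val, block_lt k' i'⟩ := by
  intro h
  have h : k.val * m + i.val = k'.val * m + i'.val := congrArg Fin.val h
  have hm : 0 < m := i.pos
  have hdiv : ∀ (a : ℕ) (b : Fin m), (a * m + b.val) / m = a := fun a b => by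
    rw [mul_comm, Nat.mul_add_div hm, Nat.div_eq_of_lt b.isLt, add_zero]
  exact hkk' (Fin.ext (by rw [← hdiv k i, h, hdiv]))

theorem measurable_subsample (π : Equiv.Perm (Fin n)) (k : Fin (n / m)) :
    Measurable fun w : Fin n → 𝒲 => subsample w π k :=
  measurable_pi_lambda _ fun _ => measurable_pi_apply _

/-- A subsample reads distinct coordinates of an iid vector. -/
theorem map_subsample (P : Measure 𝒲) [IsProbabilityMeasure P] (π : Equiv.Perm (Fin n))
    (k : Fin (n / m)) :
    (Measure.pi fun _ : Fin n => P).map (fun w => subsample w π k)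
      = Measure.pi fun _ : Fin m => P := by
  have := Measure.map_infinitePi_infinitePi_of_inj (P := fun _ : Fin n => P)
    (π.injective.comp (block_injective k))
  rwa [Measure.infinitePi_eq_pi, Measure.infinitePi_eq_pi] at this

theorem indepFun_subsample (P : Measure 𝒲) [IsProbabilityMeasure P] (π : Equiv.Perm (Fin n))
    {k k' : Fin (n / m)} (hkk' : k ≠ k') :
    IndepFun (fun w : Fin n → 𝒲 => subsample w π k) (fun w => subsample w π k')
      (Measure.pi fun _ : Fin n => P) := by
  classical
  have hiid : iIndepFun (fun (a : Fin n) (w : Fin n → 𝒲) => w a)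
      (Measure.pi fun _ : Fin n => P) :=
    iIndepFun_pi (X := fun _ => id) fun _ => aemeasurable_id
  set B : Fin (n / m) → Finset (Fin n) := fun k =>
    Finset.univ.image fun i : Fin m => π ⟨k.val * m + i.val, block_lt k i⟩ with hB
  have hmem : ∀ k (i : Fin m), π ⟨k.val * m + i.val, block_lt k i⟩ ∈ B k := fun k i =>
    Finset.mem_image_of_mem _ (Finset.mem_univ i)
  have hdisj : Disjoint (B k) (B k') := by
    rw [Finset.disjoint_left]
    intro a ha ha'
    obtain ⟨i, -, rfl⟩ := Finset.mem_image.1 ha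
    obtain ⟨i', -, h⟩ := Finset.mem_image.1 ha'
    exact block_ne hkk' i i' (π.injective h.symm)
  exact (hiid.indepFun_finset (B k) (B k') hdisj fun a => measurable_pi_apply a).comp
    (φ := fun f (i : Fin m) => f ⟨_, hmem k i⟩) (ψ := fun f (i : Fin m) => f ⟨_, hmem k' i⟩)
    (measurable_pi_lambda _ fun _ => measurable_pi_apply _)
    (measurable_pi_lambda _ fun _ => measurable_pi_apply _)

theorem measurable_subsample_prodMk (π : Equiv.Perm (Fin n)) (j : Fin J) (k : Fin (n / m)) :
    Measurable fun x : (Fin n → 𝒲) × (Fin J × Fin (n / m) → U) =>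
      (subsample x.1 π k, x.2 (j, k)) :=
  ((measurable_subsample π k).comp measurable_fst).prodMk
    ((measurable_pi_apply (j, k)).comp measurable_snd)

theorem map_subsample_prodMk (P : Measure 𝒲) [IsProbabilityMeasure P] (ν : Measure U)
    [IsProbabilityMeasure ν] (π : Equiv.Perm (Fin n)) (j : Fin J) (k : Fin (n / m)) :
    ((Measure.pi fun _ : Fin n => P).prod (Measure.pi fun _ : Fin J × Fin (n / m) => ν)).map
      (fun x => (subsample x.1 π k, x.2 (j, k))) = sampleLaw P ν m := by
  have h := Measure.map_prod_map (Measure.pi fun _ : Fin n => P)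
    (Measure.pi fun _ : Fin J × Fin (n / m) => ν) (measurable_subsample (m := m) π k)
    (measurable_pi_apply (j, k))
  rw [map_subsample, (measurePreserving_eval (fun _ : Fin J × Fin (n / m) => ν) (j, k)).map_eq]
    at h
  exact h.symm

theorem indepFun_subsample_prodMk (P : Measure 𝒲) [IsProbabilityMeasure P] (ν : Measure U)
    [IsProbabilityMeasure ν] (π : Equiv.Perm (Fin n)) (j : Fin J) {k k' : Fin (n / m)}
    (hkk' : k ≠ k') :
    IndepFun (fun x : (Fin n → 𝒲) × (Fin J × Fin (n / m) → U) =>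
        (subsample x.1 π k, x.2 (j, k)))
      (fun x => (subsample x.1 π k', x.2 (j, k')))
      ((Measure.pi fun _ : Fin n => P).prod (Measure.pi fun _ : Fin J × Fin (n / m) => ν)) := by
  have hu : iIndepFun (fun (a : Fin J × Fin (n / m)) (u : Fin J × Fin (n / m) → U) => u a)
      (Measure.pi fun _ : Fin J × Fin (n / m) => ν) :=
    iIndepFun_pi (X := fun _ => id) fun _ => aemeasurable_id
  exact indepFun_prodMk_fst_snd (measurable_subsample π k) (measurable_subsample π k')
      (measurable_pi_apply (j, k)) (measurable_pi_apply (j, k')) (indepFun_subsample P π hkk')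
      (hu.indepFun fun h => hkk' (congrArg Prod.snd h))

/-- For fixed permutations, the empirical distribution function of the estimates of one fold from
the blocks of one permutation concentrates around the distribution function of the estimator. -/
theorem measure_le_abs_empCDF_block_sub_le (P : Measure 𝒲) [IsProbabilityMeasure P]
    (ν : Measure U) [IsProbabilityMeasure ν] (hK : 0 < n / m) {f : (Fin m → 𝒲) → U → ℝ}
    (hf : Measurable fun x : (Fin m → 𝒲) × U => f x.1 x.2) (π : Equiv.Perm (Fin n)) (j : Fin J)
    (t : ℝ) {η : ℝ} (hη : 0 < η) :
    ((Measure.pi fun _ : Fin n => P).prod (Measure.pi fun _ : Fin J × Fin (n / m) => ν))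
      {x | η ≤ |empCDF (fun k => f (subsample x.1 π k) (x.2 (j, k))) t
        - (sampleLaw P ν m).real {x | f x.1 x.2 ≤ t}|}
      ≤ ENNReal.ofReal (1 / ((n / m : ℕ) * η ^ 2)) := by
  have hmeas : ∀ k : Fin (n / m), Measurable
      fun x : (Fin n → 𝒲) × (Fin J × Fin (n / m) → U) => f (subsample x.1 π k) (x.2 (j, k)) :=
    fun k => hf.comp (measurable_subsample_prodMk π j k)
  have hind : Pairwise fun k k' : Fin (n / m) => IndepFun
      (fun x : (Fin n → 𝒲) × (Fin J × Fin (n / m) → U) => f (subsample x.1 π k) (x.2 (j, k)))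
      (fun x => f (subsample x.1 π k') (x.2 (j, k')))
      ((Measure.pi fun _ : Fin n => P).prod (Measure.pi fun _ : Fin J × Fin (n / m) => ν)) :=
    fun k k' hkk' => (indepFun_subsample_prodMk P ν π j hkk').comp hf hf
  refine measure_le_abs_empCDF_sub_le hK hmeas hind hη fun k => ?_
  have hms : MeasurableSet {x : (Fin m → 𝒲) × U | f x.1 x.2 ≤ t} := hf measurableSet_Iic
  rw [← map_subsample_prodMk P ν π j k,
    map_measureReal_apply (measurable_subsample_prodMk π j k) hms]
  rfl

/-- The fixed-permutation bound does not depend on the permutations, which are independent of the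
rest, so it survives integrating them out. -/
theorem measure_law_le_abs_empCDF_block_sub_le (P : Measure 𝒲) [IsProbabilityMeasure P]
    (ν : Measure U) [IsProbabilityMeasure ν] (hK : 0 < n / m) {L : ℕ}
    {est : Fin L → (Fin m → 𝒲) → U → ℝ} (l : Fin L)
    (hest : Measurable fun x : (Fin m → 𝒲) × U => est l x.1 x.2) (j : Fin J)
    (t : ℝ) {η : ℝ} (hη : 0 < η) :
    law P ν J n m {ω | η ≤ |empCDF (fun k => subEstimates est ω ((j, k), l)) t
        - (sampleLaw P ν m).real {x | est l x.1 x.2 ≤ t}|}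
      ≤ ENNReal.ofReal (1 / ((n / m : ℕ) * η ^ 2)) := by
  set p := (sampleLaw P ν m).real {x | est l x.1 x.2 ≤ t} with hp
  set PP := Measure.pi fun _ : Fin n => P with hPP
  set PU := Measure.pi fun _ : Fin J × Fin (n / m) => ν with hPU
  set Q := Measure.pi fun _ : Fin J =>
    (PMF.uniformOfFintype (Equiv.Perm (Fin n))).toMeasure with hQ
  have hA : MeasurableSet {y : (Fin J → Equiv.Perm (Fin n)) × (Fin n → 𝒲) ×
      (Fin J × Fin (n / m) → U) |
      η ≤ |empCDF (fun k => est l (subsample y.2.1 (y.1 j) k) (y.2.2 (j, k))) t - p|} := by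
    refine measurableSet_le measurable_const ?_
    -- The permutations form a finite discrete space, so measurability is checked one tuple at a
    -- time.
    refine measurable_from_prod_countable_right fun π => ?_
    simp only [empCDF_eq_sum]
    refine (Measurable.abs ((Measurable.div_const (Finset.measurable_sum _ fun k _ =>
      Measurable.ite ?_ measurable_const measurable_const) _).sub_const p))
    exact (hest.comp (((measurable_subsample (π j) k).comp measurable_fst).prodMk
      ((measurable_pi_apply (j, k)).comp measurable_snd))) measurableSet_Iic
  have hrearr : MeasurePreserving
      (fun ω : Space 𝒲 U J n m => (ω.2.1, (ω.1, ω.2.2))) (law P ν J n m) (Q.prod (PP.prod PU)) := by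
    have h1 := (measurePreserving_prodAssoc PP Q PU).symm
    have h2 := (Measure.measurePreserving_swap (μ := PP) (ν := Q)).prod (MeasurePreserving.id PU)
    have h3 := measurePreserving_prodAssoc Q PP PU
    exact h3.comp (h2.comp h1)
  have := hrearr.measure_preimage hA.nullMeasurableSet
  refine Eq.trans_le this ?_
  rw [Measure.prod_apply hA]
  calc _ ≤ ∫⁻ _π, ENNReal.ofReal (1 / ((n / m : ℕ) * η ^ 2)) ∂Q :=
        lintegral_mono fun π =>
          measure_le_abs_empCDF_block_sub_le P ν hK hest (π j) j t hη
    _ = _ := by simp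

end Blocks

end DML

namespace DML

/-! ### Consistency -/

section Consistency

/-- Portmanteau: the boundary {t} of the half-line is Gaussian-null. -/
theorem tendsto_measureReal_le_of_tendstoInDistribution {Ω : ℕ → Type*}
    [∀ n, MeasurableSpace (Ω n)] {μ : (n : ℕ) → Measure (Ω n)} [∀ n, IsProbabilityMeasure (μ n)]
    {X : (n : ℕ) → Ω n → ℝ}
    (h : TendstoInDistribution X atTop (id : ℝ → ℝ) μ (gaussianReal 0 1)) (t : ℝ) :
    Tendsto (fun n => (μ n).real {ω | X n ω ≤ t}) atTop (𝓝 (cdf (gaussianReal 0 1) t)) := by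
  have hfr : ((gaussianReal 0 1).map id) (frontier (Set.Iic t)) = 0 := by
    rw [Measure.map_id, frontier_Iic, measure_singleton]
  have hlim := ProbabilityMeasure.tendsto_measure_of_null_frontier_of_tendsto' h.tendsto hfr
  rw [cdf_eq_real]
  simp only [ProbabilityMeasure.coe_mk, Measure.map_id] at hlim
  have hlim' := (ENNReal.tendsto_toReal (measure_ne_top _ _)).comp hlim
  refine hlim'.congr fun n => ?_
  simp only [Function.comp_apply]
  rw [Measure.map_apply_of_aemeasurable (h.forall_aemeasurable n) measurableSet_Iic]
  rfl

theorem tendsto_div_atTop_of_tendsto_ratio {m : ℕ → ℕ} (hm : Tendsto m atTop atTop)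
    (hmn : Tendsto (fun n : ℕ => (m n : ℝ) / n) atTop (𝓝 0)) :
    Tendsto (fun n => n / m n) atTop atTop := by
  rw [tendsto_atTop]
  intro b
  filter_upwards [hm.eventually_gt_atTop 0, eventually_gt_atTop 0,
    hmn.eventually_lt_const (by positivity : (0 : ℝ) < 1 / (b + 1))] with n h1 h2 h3
  rw [Nat.le_div_iff_mul_le h1]
  have h2' : (0 : ℝ) < n := by exact_mod_cast h2
  rw [div_lt_div_iff₀ h2' (by positivity)] at h3
  have : ((b * m n : ℕ) : ℝ) ≤ n := by
    push_cast
    nlinarith [(Nat.cast_nonneg (m n) : (0 : ℝ) ≤ m n)]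
  exact_mod_cast this

/-- The estimator is σ/s, and s ≥ 1/2 gives |σ/s − σ| ≤ 2σ|s − 1| ≤ δ/2. -/
theorem abs_sigmaLS_sub_lt {𝒲 U : Type*} {L J n m : ℕ} (hL : 0 < L) (hm : 0 < m) {ε σ δ θ₀ : ℝ}
    (hσ : 0 < σ) (hδ : 0 < δ) (est : Fin L → (Fin m → 𝒲) → U → ℝ) (ω : Space 𝒲 U J n m)
    (T : (Fin J × Fin (n / m)) × Fin L → ℝ)
    (hT : T = fun bl => Real.sqrt ((m : ℝ) / L) / σ * (subEstimates est ω bl - θ₀))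
    (h : |lsSlope (trimmed ε T) T (rankTransform T) - 1| ≤ min (1 / 2) (δ / (4 * σ))) :
    |sigmaLS ε est ω - σ| < δ := by
  have hr : 0 < Real.sqrt ((m : ℝ) / L) := Real.sqrt_pos.2 (by positivity)
  have hc : 0 < Real.sqrt ((m : ℝ) / L) / σ := div_pos hr hσ
  set s := lsSlope (trimmed ε T) T (rankTransform T) with hs
  have hs' : s = lsSlope (trimmed ε (subEstimates est ω)) (subEstimates est ω)
      (rankTransform (subEstimates est ω)) / (Real.sqrt ((m : ℝ) / L) / σ) := by
    rw [hs, hT, trimmed_affine _ _ hc, rankTransform_affine _ hc, lsSlope_affine _ _ _ hc.ne']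
  have h1 := h.trans (min_le_left _ _)
  have h2 := h.trans (min_le_right _ _)
  have hspos : 1 / 2 ≤ s := by linarith [(abs_le.1 h1).1]
  have hs0 : 0 < s := by linarith
  have heq : sigmaLS ε est ω = σ / s := by
    rw [eq_div_iff hc.ne'] at hs'
    rw [sigmaLS, ← hs']
    field_simp
  have hdiff : σ / s - σ = -(σ * (s - 1)) / s := by
    field_simp
    ring
  rw [heq, hdiff, abs_div, abs_neg, abs_mul, abs_of_pos hσ, abs_of_pos hs0, div_lt_iff₀ hs0]
  rw [le_div_iff₀ (by positivity)] at h2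
  nlinarith

end Consistency

end DML

/-! ### Assembly of the two halves. -/

theorem proposition2 {𝒲 U H : Type*} [MeasurableSpace 𝒲] [MeasurableSpace U]
    (P : Measure 𝒲) [IsProbabilityMeasure P] (ν : Measure U) [IsProbabilityMeasure ν]
    (ψa ψb : 𝒲 → H → ℝ) (θ₀ : ℝ) (η₀ : H) (hσ : 0 < DML.sigma P ψa ψb θ₀ η₀)
    (L : ℕ) (hL : 0 < L)
    (fold : (n : ℕ) → U → Fin n → Fin L) (hfold : DML.BalancedFolds fold)
    (learner : (n : ℕ) → Fin L → (I : Finset (Fin n)) → (I → 𝒲) → U → H)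
    (hmeas : ∀ (n : ℕ) (l : Fin L), Measurable fun x : (Fin n → 𝒲) × U =>
      DML.thetaHat ψa ψb fold learner n l x.1 x.2)
    (hexch : ∀ n : ℕ, DML.Exchangeable
      (fun (l : Fin L) (x : (Fin n → 𝒲) × U) => DML.thetaHat ψa ψb fold learner n l x.1 x.2)
      (DML.sampleLaw P ν n))
    (hclt : ∀ l : Fin L, TendstoInDistribution
      (fun (n : ℕ) (x : (Fin n → 𝒲) × U) =>
        Real.sqrt ((n : ℝ) / L) * (DML.thetaHat ψa ψb fold learner n l x.1 x.2 - θ₀) /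
          DML.sigma P ψa ψb θ₀ η₀)
      atTop (id : ℝ → ℝ) (fun n : ℕ => DML.sampleLaw P ν n) (gaussianReal 0 1))
    (m : ℕ → ℕ) (hm : Tendsto m atTop atTop)
    (hmn : Tendsto (fun n : ℕ => (m n : ℝ) / n) atTop (𝓝 0))
    (J : ℕ) (hJ : 0 < J) (ε : ℝ) (hε : 0 < ε) (hε' : ε < 1) :
    DML.TendstoInProbability (fun n : ℕ => DML.law P ν J n (m n))
      (fun (n : ℕ) (ω : DML.Space 𝒲 U J n (m n)) =>
        DML.sigmaLS ε (DML.thetaHat ψa ψb fold learner (m n)) ω)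
      (DML.sigma P ψa ψb θ₀ η₀) := by
  intro δ hδ
  set σ := DML.sigma P ψa ψb θ₀ η₀ with hσdef
  set c : ℕ → ℝ := fun n => Real.sqrt ((n : ℝ) / L) / σ with hc
  set est : (n : ℕ) → Fin L → (Fin n → 𝒲) → U → ℝ := fun n l w u =>
    c n * (DML.thetaHat ψa ψb fold learner n l w u - θ₀) with hest
  have hestm : ∀ n l, Measurable fun x : (Fin n → 𝒲) × U => est n l x.1 x.2 := fun n l =>
    ((hmeas n l).sub_const θ₀).const_mul (c n)
  set p : ℕ → Fin L → ℝ → ℝ := fun n l t =>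
    (DML.sampleLaw P ν n).real {x | est n l x.1 x.2 ≤ t} with hp
  have hlim : ∀ l t, Tendsto (fun n => p n l t) atTop (𝓝 (cdf (gaussianReal 0 1) t)) := by
    intro l t
    refine (DML.tendsto_measureReal_le_of_tendstoInDistribution (hclt l) t).congr fun n => ?_
    simp only [hp, hest, hc, div_mul_eq_mul_div]
  obtain ⟨S, η, hη, N₀, hS⟩ := DML.exists_lsSlope_close hε hε'
    (lt_min one_half_pos (div_pos hδ (by positivity : 0 < 4 * σ)))
  have hK := DML.tendsto_div_atTop_of_tendsto_ratio hm hmn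
  have hbound : ∀ᶠ n in atTop, DML.law P ν J n (m n)
      {ω | δ ≤ |DML.sigmaLS ε (DML.thetaHat ψa ψb fold learner (m n)) ω - σ|}
      ≤ ∑ _t ∈ S, ∑ _jl : Fin J × Fin L,
        ENNReal.ofReal (1 / ((n / m n : ℕ) * (η / 2) ^ 2)) := by
    have hp_close : ∀ᶠ n in atTop, ∀ t ∈ S, ∀ l,
        |p (m n) l t - cdf (gaussianReal 0 1) t| < η / 2 := by
      rw [Filter.eventually_all_finset]
      intro t _
      rw [Filter.eventually_all]
      intro l
      exact (Metric.tendsto_nhds.1 ((hlim l t).comp hm)) (η / 2) (half_pos hη)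
    -- The `+ 1` also makes the number of blocks positive when `N₀` is zero.
    filter_upwards [hp_close, hm.eventually_gt_atTop 0, hK.eventually_ge_atTop (N₀ + 1)]
      with n hpn hmn0 hKn
    have hK0 : 0 < n / m n := by omega
    have : Nonempty (Fin (n / m n)) := ⟨⟨0, hK0⟩⟩
    have : Nonempty (Fin J × Fin L) := ⟨⟨0, hJ⟩, ⟨0, hL⟩⟩
    have : Nonempty ((Fin J × Fin (n / m n)) × Fin L) :=
      ⟨(⟨0, hJ⟩, ⟨0, hK0⟩), ⟨0, hL⟩⟩
    -- Half of η is spent on the random deviation from the exact distribution function at sample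
    -- size m(n), half on the distance of that function from Φ.
    refine le_trans (measure_mono (t := ⋃ t ∈ S, ⋃ jl : Fin J × Fin L,
      {ω | η / 2 ≤ |DML.empCDF (fun k => DML.subEstimates (est (m n)) ω ((jl.1, k), jl.2)) t
        - p (m n) jl.2 t|}) ?_) ?_
    · intro ω hω
      by_contra hnot
      simp only [Set.mem_iUnion, Set.mem_ofPred_eq, not_exists, not_le] at hnot
      have hω' : δ ≤ |DML.sigmaLS ε (DML.thetaHat ψa ψb fold learner (m n)) ω - σ| := hω
      refine absurd hω' (not_le.2 ?_)
      refine DML.abs_sigmaLS_sub_lt hL hmn0 hσ hδ _ ω (DML.subEstimates (est (m n)) ω) rfl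
        (hS _ _ ?_ fun t ht => ?_)
      · simp only [Fintype.card_prod, Fintype.card_fin]
        calc N₀ ≤ 1 * (n / m n) * 1 := by omega
          _ ≤ J * (n / m n) * L := by gcongr <;> omega
      -- Regroups indices so that each slice holds the blocks of one permutation and one fold.
      · let e : Fin (n / m n) × (Fin J × Fin L) ≃ (Fin J × Fin (n / m n)) × Fin L :=
          { toFun := fun a => ((a.2.1, a.1), a.2.2)
            invFun := fun b => (b.1.2, (b.1.1, b.2)) }
        refine DML.abs_empCDF_prod_sub_lt e fun jl => ?_
        have h1 := hnot t ht jl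
        have h2 := hpn t ht jl.2
        calc _ ≤ |DML.empCDF (fun k => DML.subEstimates (est (m n)) ω ((jl.1, k), jl.2)) t
                - p (m n) jl.2 t| + |p (m n) jl.2 t - cdf (gaussianReal 0 1) t| :=
              abs_sub_le _ _ _
          _ < η := by linarith
    · refine (measure_biUnion_finset_le S _).trans (Finset.sum_le_sum fun t _ => ?_)
      refine (measure_iUnion_fintype_le _ _).trans (Finset.sum_le_sum fun jl _ => ?_)
      exact DML.measure_law_le_abs_empCDF_block_sub_le P ν hK0 jl.2 (hestm (m n) jl.2) jl.1 t
        (half_pos hη)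
  have hzero : Tendsto (fun n => ∑ _t ∈ S, ∑ _jl : Fin J × Fin L,
      ENNReal.ofReal (1 / ((n / m n : ℕ) * (η / 2) ^ 2))) atTop (𝓝 0) := by
    have h1 : Tendsto (fun n => 1 / (((n / m n : ℕ) : ℝ) * (η / 2) ^ 2)) atTop (𝓝 0) :=
      tendsto_const_nhds.div_atTop ((tendsto_natCast_atTop_atTop.comp hK).atTop_mul_const
        (by positivity))
    have h2 := ENNReal.tendsto_ofReal h1
    rw [ENNReal.ofReal_zero] at h2
    simpa using tendsto_finsetSum S fun _ _ =>
      tendsto_finsetSum (Finset.univ : Finset (Fin J × Fin L)) fun _ _ => h2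
  exact tendsto_of_tendsto_of_tendsto_of_le_of_le' tendsto_const_nhds hzero
    (Eventually.of_forall fun _ => zero_le) hbound
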